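/- A hypergraph is $\mathcal H=(V,E)$ with $V$ a finite vertex set and $E$ a set of subsets of $V$ (hyperedges); it is $k$-uniform if every hyperedge has exactly $k$ vertices. For $t\ge 3$, $\mathcal H$ contains a Berge cycle of length $t$ (a Berge-$C_t$) if there are $t$ distinct vertices $v_1,\dots,v_t$ and $t$ distinct hyperedges $h_1,\dots,h_t$ such that $\{v_i,v_{i+1}\}\subseteq h_i$ for all $1\le i\le t$, where $v_{t+1}=v_1$. The Lagrangian of a $k$-uniform hypergraph $\mathcal H$ is $$\lambda(\mathcal H)=\max\Big\{\sum_{e\in E}\ \prod_{v\in e}x_v \;:\; x\in\mathbb R_{\ge 0}^{V},\ \sum_{v\in V}|x_v|=1\Big\},$$ and $K^k_m$ denotes the $k$-uniform hypergraph on $m$ vertices whose hyperedges are all the $k$-element subsets of the vertex set. Theorem. For every integer $k\ge 2$ there is an integer $t_0=t_0(k)$ such that for every $t\ge t_0$ $$\lambda(K^k_{t-1})=\frac{1}{(t-1)^k}\binom{t-1}{k},$$ and, for every $n\ge t-1$: (i) every $k$-uniform hypergraph $\mathcal H$ on $n$ vertices that contains no Berge cycle of length $t$ satisfies $\lambda(\mathcal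 H)\le\lambda(K^k_{t-1})$; (ii) the bound is attained: there is a $k$-uniform hypergraph $\mathcal H$ on $n$ vertices that contains no Berge cycle of length $t$ and has $\lambda(\mathcal H)=\lambda(K^k_{t-1})$. -/

import Mathlib

universe u

namespace Hypergraph

/-- `H` is a `k`-graph: every hyperedge has exactly `k` vertices. -/
def IsUniform {α : Type*} (H : Hypergraph α) (k : ℕ) : Prop :=
  ∀ e ∈ H.edgeSet, e.encard = k

/-- `H` contains a Berge cycle of length `t` (where `t ≥ 3`): there are distinct vertices
`v 0, …, v (t - 1)` and distinct hyperedges `h 0, …, h (t - 1)` such that `h i` contains `v i` and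
its cyclic successor `v (i + 1)`, the index being read modulo `t`. -/
def HasBergeCycle {α : Type*} (H : Hypergraph α) (t : ℕ) : Prop :=
  3 ≤ t ∧ ∃ (v : Fin t → α) (h : Fin t → Set α),
    Function.Injective v ∧ Function.Injective h ∧
      ∀ i, h i ∈ H.edgeSet ∧ v i ∈ h i ∧ v (finRotate t i) ∈ h i

/-- The polynomial form `P_H(x) = ∑_{e ∈ E(H)} ∏_{v ∈ e} x_v` of a finite hypergraph. Only the
values of `x` at vertices of `H` matter. -/
noncomputable def polyForm {α : Type*} (H : Hypergraph α) (x : α → ℝ) : ℝ :=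
  ∑ᶠ e ∈ H.edgeSet, ∏ᶠ v ∈ e, x v

/-- The nonnegative weightings of the vertices of a finite hypergraph with `1`-norm one. -/
def weightings {α : Type*} (H : Hypergraph α) : Set (α → ℝ) :=
  {x | (∀ v ∈ H.vertexSet, 0 ≤ x v) ∧ ∑ᶠ v ∈ H.vertexSet, |x v| = 1}

/-- The Lagrangian of a finite hypergraph: the largest value of its polynomial form over all
nonnegative weightings with `1`-norm one. By `isGreatest_lagrangian` below this supremum is a
maximum as soon as there is a vertex. -/
noncomputable def lagrangian {α : Type*} (H : Hypergraph α) : ℝ :=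
  sSup (H.polyForm '' H.weightings)

/-- The complete `k`-graph on `m` vertices. -/
def completeUniform (k m : ℕ) : Hypergraph (Fin m) where
  vertexSet := Set.univ
  edgeSet := {e | e.encard = k}
  subset_vertexSet_of_mem_edgeSet' := fun _ _ => Set.subset_univ _

theorem isGreatest_lagrangian {α : Type*} (H : Hypergraph α) (hfin : H.vertexSet.Finite)
    (hne : H.vertexSet.Nonempty) :
    IsGreatest (H.polyForm '' H.weightings) H.lagrangian := by
  classical
  have hE : H.edgeSet.Finite :=
    hfin.finite_subsets.subset fun e he => H.subset_vertexSet_of_mem_edgeSet' he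
  have hef : ∀ e ∈ H.edgeSet, e.Finite :=
    fun e he => hfin.subset (H.subset_vertexSet_of_mem_edgeSet' he)
  have : Fintype H.vertexSet := hfin.fintype
  have : Nonempty H.vertexSet := hne.to_subtype
  -- extension of a weighting by zero outside the vertex set
  let ext0 : (H.vertexSet → ℝ) → α → ℝ :=
    fun y a => if h : a ∈ H.vertexSet then y ⟨a, h⟩ else 0
  have hext : Continuous ext0 := by
    refine continuous_pi fun a => ?_
    by_cases h : a ∈ H.vertexSet
    · simpa [ext0, h] using continuous_apply (⟨a, h⟩ : H.vertexSet)
    · simpa [ext0, h] using continuous_const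
  have hP : Continuous H.polyForm := by
    have : H.polyForm = fun x => ∑ e ∈ hE.toFinset.attach,
        ∏ v ∈ (hef e.1 (hE.mem_toFinset.1 e.2)).toFinset, x v := by
      funext x
      unfold polyForm
      rw [finsum_mem_eq_finite_toFinset_sum _ hE, ← Finset.sum_attach]
      refine Finset.sum_congr rfl fun e _ => ?_
      exact finprod_mem_eq_finite_toFinset_prod _ _
    rw [this]
    fun_prop
  have hsum : ∀ x : α → ℝ, ∑ᶠ v ∈ H.vertexSet, |x v| = ∑ v : H.vertexSet, |x v| := by
    intro x
    rw [← finsum_set_coe_eq_finsum_mem, finsum_eq_sum_of_fintype]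
  have himg : H.polyForm '' H.weightings =
      (fun y => H.polyForm (ext0 y)) '' stdSimplex ℝ H.vertexSet := by
    ext r
    constructor
    · rintro ⟨x, ⟨hx0, hx1⟩, rfl⟩
      refine ⟨fun v => x v, ⟨fun v => hx0 v v.2, ?_⟩, ?_⟩
      · rw [hsum] at hx1
        rw [← hx1]
        exact Finset.sum_congr rfl fun v _ => (abs_of_nonneg (hx0 v v.2)).symm
      · refine finsum_mem_congr rfl fun e he => finprod_mem_congr rfl fun v hv => ?_
        simp [ext0, H.subset_vertexSet_of_mem_edgeSet' he hv]
    · rintro ⟨y, ⟨hy0, hy1⟩, rfl⟩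
      refine ⟨ext0 y, ⟨fun v hv => ?_, ?_⟩, rfl⟩
      · simpa [ext0, hv] using hy0 ⟨v, hv⟩
      · rw [hsum, ← hy1]
        refine Finset.sum_congr rfl fun v _ => ?_
        simpa [ext0] using hy0 v
  have hcpt : IsCompact (H.polyForm '' H.weightings) := by
    rw [himg]
    exact (isCompact_stdSimplex ℝ H.vertexSet).image (hP.comp hext)
  have hnon : (H.polyForm '' H.weightings).Nonempty := by
    rw [himg]
    exact ⟨_, _, single_mem_stdSimplex ℝ (Classical.arbitrary H.vertexSet), rfl⟩
  exact hcpt.isGreatest_sSup hnon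

end Hypergraph

/-! For weights maximising the polynomial form with respect to a pair of vertices in no common
hyperedge, the form is linear in shifting weight between them, so one of the two can be emptied at
no loss. Hence the support may be assumed pairwise covered (`exists_edgeForm_le_of_covered`). If it
has fewer than `t` vertices, it fits in a set of `t - 1` vertices and Maclaurin's inequality
(`edgeForm_powersetCard_le`) gives the bound.

Otherwise choose `t` vertices of the support and colour each ordered pair by a hyperedge containing
it. A Berge cycle is then a rainbow Hamilton cycle, and each colour lives on at most `k` vertices. A
uniformly random cyclic order is rainbow with positive probability for `t ≥ 3072 k²`
(`exists_rainbow_tour`). This is the lopsided local lemma (`avoiding_nonempty`): a bad event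
prescribes a partial matching of positions to values, and matchings sharing no position and no value
are negatively correlated (`card_permsExtending_inter_avoiding_le`). -/

/-! ### The lopsided local lemma, by counting. -/

open Finset in
/-- The outcomes at which none of the events `A i`, `i ∈ S`, occurs. -/
def avoiding {Ω ι : Type*} [Fintype Ω] [DecidableEq Ω] (A : ι → Finset Ω) (S : Finset ι) :
    Finset Ω :=
  univ.filter fun ω => ∀ i ∈ S, ω ∉ A i

open Finset in
theorem card_avoiding_le_add_sum {Ω ι : Type*} [Fintype Ω] [DecidableEq Ω] [DecidableEq ι]
    (A : ι → Finset Ω) {S₁ S₂ S : Finset ι} (hS : S ⊆ S₁ ∪ S₂) :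
    #(avoiding A S₂) ≤ #(avoiding A S) + ∑ j ∈ S₁, #(A j ∩ avoiding A S₂) := by
  have hsub : avoiding A S₂ ⊆ avoiding A S ∪ S₁.biUnion fun j => A j ∩ avoiding A S₂ := by
    intro ω hω
    by_cases h : ω ∈ avoiding A S
    · exact mem_union_left _ h
    · refine mem_union_right _ ?_
      simp only [avoiding, mem_filter, mem_univ, true_and, not_forall, not_not] at h hω
      obtain ⟨j, hj, hωj⟩ := h
      simp only [mem_biUnion, mem_inter, avoiding, mem_filter, mem_univ, true_and]
      rcases mem_union.1 (hS hj) with h1 | h2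
      · exact ⟨j, h1, hωj, hω⟩
      · exact absurd hωj (hω j h2)
  exact (card_le_card hsub).trans <| (card_union_le _ _).trans <|
    Nat.add_le_add_left card_biUnion_le _

-- In probabilities, P(A i | avoid S) ≤ 2 P(A i). Split `S` into neighbours of `i` and the rest S₂.
-- Dropping the neighbours only enlarges the left side, and `hneg` bounds it by P(A i) P(avoid S₂).
-- By induction the neighbours cover at most half of the outcomes avoiding S₂, so P(avoid S₂) ≤ 2
-- P(avoid S).
open Finset in
theorem card_inter_avoiding_le {Ω ι : Type*} [Fintype Ω] [DecidableEq Ω] [Nonempty Ω]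
    [DecidableEq ι] (A : ι → Finset Ω) (R : ι → ι → Prop) [DecidableRel R] (F : Finset ι)
    (hneg : ∀ i ∈ F, ∀ S ⊆ F, (∀ j ∈ S, ¬ R i j) →
      Fintype.card Ω * #(A i ∩ avoiding A S) ≤ #(A i) * #(avoiding A S))
    (hsum : ∀ i ∈ F, 4 * ∑ j ∈ F.filter (R i), #(A j) ≤ Fintype.card Ω) (S : Finset ι) :
    S ⊆ F → ∀ i ∈ F, Fintype.card Ω * #(A i ∩ avoiding A S) ≤ 2 * #(A i) * #(avoiding A S) := by
  induction S using Finset.strongInduction with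
  | H S ih =>
  intro hSF i hi
  have hN : 0 < Fintype.card Ω := Fintype.card_pos
  have hS₂F : S.filter (fun j => ¬ R i j) ⊆ F := (filter_subset _ _).trans hSF
  have h2 := hneg i hi (S.filter fun j => ¬ R i j) hS₂F (fun j hj => (mem_filter.1 hj).2)
  -- Without neighbours in `S` there is no smaller set to induct on, but `h2` already suffices.
  by_cases hS : S.filter (fun j => ¬ R i j) = S
  · rw [hS] at h2
    nlinarith [Nat.zero_le (#(A i) * #(avoiding A S))]
  have ih' := ih _ ((filter_subset _ S).ssubset_of_ne hS) hS₂F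
  have hmono : avoiding A S ⊆ avoiding A (S.filter fun j => ¬ R i j) := by
    intro ω hω
    simp only [avoiding, mem_filter, mem_univ, true_and] at hω ⊢
    exact fun j hj => hω j hj.1
  have hle := card_le_card (inter_subset_inter (Subset.refl (A i)) hmono)
  have hcov := card_avoiding_le_add_sum A (S₁ := S.filter (R i))
    (S₂ := S.filter fun j => ¬ R i j) (S := S) (filter_union_filter_not_eq _ _).ge
  have hbad : Fintype.card Ω *
      ∑ j ∈ S.filter (R i), #(A j ∩ avoiding A (S.filter fun j => ¬ R i j)) ≤
      2 * (∑ j ∈ F.filter (R i), #(A j)) * #(avoiding A (S.filter fun j => ¬ R i j)) := by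
    calc _ ≤ ∑ j ∈ S.filter (R i), 2 * #(A j) * #(avoiding A (S.filter fun j => ¬ R i j)) := by
          rw [mul_sum]
          exact sum_le_sum fun j hj => ih' j (hSF (mem_filter.1 hj).1)
      _ ≤ ∑ j ∈ F.filter (R i), 2 * #(A j) * #(avoiding A (S.filter fun j => ¬ R i j)) :=
          sum_le_sum_of_subset (filter_subset_filter _ hSF)
      _ = _ := by rw [mul_sum, sum_mul]
  have hs := hsum i hi
  generalize #(avoiding A (S.filter fun j => ¬ R i j)) = g₂ at *
  generalize #(avoiding A S) = g at *
  generalize ∑ j ∈ F.filter (R i), #(A j) = w at *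
  have hg : g₂ ≤ 2 * g := by
    have h1 := Nat.mul_le_mul_left (Fintype.card Ω) hcov
    have h3 := Nat.mul_le_mul_right g₂ hs
    refine Nat.le_of_mul_le_mul_left ?_ hN
    nlinarith
  calc _ ≤ _ := Nat.mul_le_mul_left _ hle
    _ ≤ #(A i) * g₂ := h2
    _ ≤ #(A i) * (2 * g) := Nat.mul_le_mul_left _ hg
    _ = _ := by ring

open Finset in
/-- The lopsided local lemma on a finite probability space with uniform measure. -/
theorem avoiding_nonempty {Ω ι : Type*} [Fintype Ω] [DecidableEq Ω] [Nonempty Ω]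
    [DecidableEq ι] (A : ι → Finset Ω) (R : ι → ι → Prop) [DecidableRel R] (F : Finset ι)
    (hrefl : ∀ i ∈ F, R i i)
    (hneg : ∀ i ∈ F, ∀ S ⊆ F, (∀ j ∈ S, ¬ R i j) →
      Fintype.card Ω * #(A i ∩ avoiding A S) ≤ #(A i) * #(avoiding A S))
    (hsum : ∀ i ∈ F, 4 * ∑ j ∈ F.filter (R i), #(A j) ≤ Fintype.card Ω) :
    (avoiding A F).Nonempty := by
  have key : ∀ S ⊆ F, 0 < #(avoiding A S) := by
    intro S
    induction S using Finset.induction_on with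
    | empty => intro _; simp [avoiding, Fintype.card_pos]
    | insert i S _ ih =>
      intro hS
      have hi : i ∈ F := hS (mem_insert_self _ _)
      have hSF : S ⊆ F := (subset_insert _ _).trans hS
      have h1 := card_inter_avoiding_le A R F hneg hsum S hSF i hi
      have h2 : 4 * #(A i) ≤ Fintype.card Ω := by
        refine le_trans (Nat.mul_le_mul_left 4 ?_) (hsum i hi)
        exact single_le_sum (f := fun j => #(A j)) (fun _ _ => Nat.zero_le _)
          (mem_filter.2 ⟨hi, hrefl i hi⟩)
      have hcov := card_avoiding_le_add_sum A (S₁ := {i}) (S₂ := S) (S := insert i S)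
        (insert_eq i S).le
      rw [sum_singleton] at hcov
      have hpos := ih hSF
      have hN : 0 < Fintype.card Ω := Fintype.card_pos
      generalize #(avoiding A S) = g at *
      -- If nothing survived, `A i` would cover `avoiding A S`, forcing N ≤ 2 #(A i), against 4 #(A
      -- i) ≤ N.
      by_contra h0
      have h0 : #(avoiding A (insert i S)) = 0 := by omega
      rw [h0] at hcov
      have h3 : Fintype.card Ω * g ≤ 2 * #(A i) * g := by
        refine le_trans (Nat.mul_le_mul_left _ ?_) h1
        omega
      have h4 := Nat.le_of_mul_le_mul_right h3 hpos
      omega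
  exact card_pos.1 (key F Subset.rfl)

/-! ### Random permutations and partial matchings. -/

open Finset in
/-- The permutations extending the partial matching `M`. -/
def permsExtending {V : Type*} [Fintype V] [DecidableEq V] (M : Finset (V × V)) :
    Finset (Equiv.Perm V) :=
  univ.filter fun σ => ∀ x ∈ M, σ x.1 = x.2

open Finset in
theorem card_perm_eqOn {V : Type*} [Fintype V] [DecidableEq V] (P : Finset V)
    (τ : Equiv.Perm V) :
    #(univ.filter fun σ : Equiv.Perm V => ∀ p ∈ P, σ p = τ p) = (Fintype.card V - #P).factorial := by
  have h1 : #(univ.filter fun σ : Equiv.Perm V => ∀ p ∈ P, σ p = τ p) =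
      #(univ.filter fun σ : Equiv.Perm V => ∀ p, ¬ p ∉ P → σ p = p) := by
    refine card_bij' (fun σ _ => τ⁻¹ * σ) (fun σ _ => τ * σ) ?_ ?_ ?_ ?_
    · intro σ hσ
      simp only [mem_filter, mem_univ, true_and, not_not] at hσ ⊢
      intro p hp
      simp [hσ p hp]
    · intro σ hσ
      simp only [mem_filter, mem_univ, true_and, not_not] at hσ ⊢
      intro p hp
      simp [hσ p hp]
    · intros; simp
    · intros; simp
  rw [h1, ← Fintype.card_subtype, ← Fintype.card_congr
    (Equiv.Perm.subtypeEquivSubtypePerm (fun p => p ∉ P)), Fintype.card_perm,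
    Fintype.card_subtype_compl, Fintype.card_coe]

-- The bijection σ p ↦ τ p between the two images of `P` extends to a permutation of their union,
-- and by the identity elsewhere.
open Finset in
theorem exists_perm_map_of_perm {V : Type*} [Fintype V] [DecidableEq V] (P : Finset V)
    (σ τ : Equiv.Perm V) :
    ∃ π : Equiv.Perm V, (∀ p ∈ P, π (σ p) = τ p) ∧
      ∀ a, a ∉ P.image σ → a ∉ P.image τ → π a = a := by
  classical
  let W := {a : V // a ∈ P.image σ ∪ P.image τ}
  have hmem : ∀ (ρ : Equiv.Perm V) a, a ∈ P.image ρ ↔ ρ.symm a ∈ P := by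
    intro ρ a
    constructor
    · intro h
      obtain ⟨p, hp, rfl⟩ := mem_image.1 h
      simpa using hp
    · intro h
      exact mem_image.2 ⟨_, h, by simp⟩
  let e : {a : W // a.1 ∈ P.image σ} ≃ {a : W // a.1 ∈ P.image τ} :=
    { toFun := fun a => ⟨⟨τ (σ.symm a.1.1), mem_union_right _ (mem_image_of_mem _
          ((hmem σ _).1 a.2))⟩, mem_image_of_mem _ ((hmem σ _).1 a.2)⟩
      invFun := fun a => ⟨⟨σ (τ.symm a.1.1), mem_union_left _ (mem_image_of_mem _
          ((hmem τ _).1 a.2))⟩, mem_image_of_mem _ ((hmem τ _).1 a.2)⟩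
      left_inv := fun a => by simp
      right_inv := fun a => by simp }
  refine ⟨Equiv.Perm.ofSubtype (p := fun a => a ∈ P.image σ ∪ P.image τ) e.extendSubtype, ?_, ?_⟩
  · intro p hp
    have hσp : σ p ∈ P.image σ := mem_image_of_mem _ hp
    rw [Equiv.Perm.ofSubtype_apply_of_mem _ (mem_union_left _ hσp),
      Equiv.extendSubtype_apply_of_mem e ⟨σ p, mem_union_left _ hσp⟩ hσp]
    simp [e]
  · intro a h1 h2
    exact Equiv.Perm.ofSubtype_apply_of_not_mem _ (by simp only [mem_union]; tauto)

open Finset in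
/-- Prescribing a partial matching is negatively correlated with any partial matchings
that use other positions and other values. -/
theorem card_permsExtending_inter_avoiding_le {V : Type*} [Fintype V] [DecidableEq V]
    (M : Finset (V × V)) (S : Finset (Finset (V × V)))
    (hS : ∀ M' ∈ S, ¬ ∃ x ∈ M, ∃ y ∈ M', x.1 = y.1 ∨ x.2 = y.2) :
    Fintype.card (Equiv.Perm V) * #(permsExtending M ∩ avoiding permsExtending S) ≤
      #(permsExtending M) * #(avoiding permsExtending S) := by
  rcases (permsExtending M).eq_empty_or_nonempty with h0 | ⟨σ₀, hσ₀⟩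
  · simp [h0]
  have hσ₀' : ∀ x ∈ M, σ₀ x.1 = x.2 := (mem_filter.1 hσ₀).2
  set P := M.image Prod.fst with hP
  have hA : ∀ σ : Equiv.Perm V, σ ∈ permsExtending M ↔ ∀ p ∈ P, σ p = σ₀ p := by
    intro σ
    simp only [permsExtending, mem_filter, mem_univ, true_and, hP, mem_image,
      forall_exists_index, and_imp]
    constructor
    · rintro h p x hx rfl
      rw [h x hx, hσ₀' x hx]
    · intro h x hx
      rw [h _ x hx rfl, hσ₀' x hx]
  have hcardA : #(permsExtending M) = (Fintype.card V - #P).factorial := by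
    rw [← card_perm_eqOn P σ₀]
    congr 1
    ext σ
    simp [hA]
  -- Left multiplication by `π` changes the values on `P` from those of `σ₀` to those of `τ`. It
  -- creates no matching of `S`: a value prescribed there is fixed by `π`, so it was already taken
  -- at the same position.
  have hstep : ∀ τ : Equiv.Perm V, #(permsExtending M ∩ avoiding permsExtending S) ≤
      #((avoiding permsExtending S).filter fun σ => ∀ p ∈ P, σ p = τ p) := by
    intro τ
    obtain ⟨π, hπ, hπ'⟩ := exists_perm_map_of_perm P σ₀ τ
    refine card_le_card_of_injOn (fun σ => π * σ) ?_ ?_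
    · intro σ hσ
      obtain ⟨h1, h2⟩ := mem_inter.1 (mem_coe.1 hσ)
      have h1' := (hA σ).1 h1
      simp only [avoiding, mem_filter, mem_univ, true_and] at h2
      simp only [coe_filter, Set.mem_ofPred_eq, avoiding, mem_filter, mem_univ, true_and]
      have hval : ∀ p ∈ P, (π * σ) p = τ p := fun p hp => by
        rw [Equiv.Perm.mul_apply, h1' p hp, hπ p hp]
      refine ⟨fun M' hM' hmem => h2 M' hM' ?_, hval⟩
      simp only [permsExtending, mem_filter, mem_univ, true_and] at hmem ⊢
      intro y hy
      have hy1 := hmem y hy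
      have hno := hS M' hM'
      push Not at hno
      have hyP : y.1 ∉ P := by
        intro h
        obtain ⟨x, hx, hxy⟩ := mem_image.1 h
        exact (hno x hx y hy).1 hxy
      have ha : y.2 ∉ P.image σ₀ := by
        intro h
        obtain ⟨p, hp, hpy⟩ := mem_image.1 h
        obtain ⟨x, hx, rfl⟩ := mem_image.1 hp
        exact (hno x hx y hy).2 (by rw [← hσ₀' x hx, hpy])
      have hb : y.2 ∉ P.image τ := by
        intro h
        obtain ⟨p, hp, hpy⟩ := mem_image.1 h
        rw [← hval p hp, ← hy1] at hpy
        exact hyP ((π * σ).injective hpy ▸ hp)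
      have := hπ' _ ha hb
      rw [Equiv.Perm.mul_apply] at hy1
      exact π.injective (by rw [hy1, this])
    · intro σ _ σ' _ h
      exact mul_left_cancel h
  -- Sum `hstep` over all `τ` and double count: each `σ` agrees on `P` with exactly #(permsExtending
  -- M) permutations.
  calc Fintype.card (Equiv.Perm V) * #(permsExtending M ∩ avoiding permsExtending S)
      = ∑ τ : Equiv.Perm V, #(permsExtending M ∩ avoiding permsExtending S) := by
        simp
    _ ≤ ∑ τ : Equiv.Perm V,
        #((avoiding permsExtending S).filter fun σ => ∀ p ∈ P, σ p = τ p) :=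
        sum_le_sum fun τ _ => hstep τ
    _ = ∑ σ ∈ avoiding permsExtending S,
        #(univ.filter fun τ : Equiv.Perm V => ∀ p ∈ P, σ p = τ p) := by
        simp only [card_filter]
        exact sum_comm
    _ = ∑ σ ∈ avoiding permsExtending S, #(permsExtending M) := by
        refine sum_congr rfl fun σ _ => ?_
        rw [hcardA, ← card_perm_eqOn P σ]
        simp only [eq_comm]
    _ = _ := by rw [sum_const, smul_eq_mul, mul_comm]

/-! ### Permutations with a few prescribed values. -/

open Finset in
theorem card_perm_agree_le {V : Type*} [Fintype V] [DecidableEq V] (P : Finset V) (f : V → V) :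
    #(univ.filter fun σ : Equiv.Perm V => ∀ p ∈ P, σ p = f p) ≤
      (Fintype.card V - #P).factorial := by
  rcases (univ.filter fun σ : Equiv.Perm V => ∀ p ∈ P, σ p = f p).eq_empty_or_nonempty with
    h0 | ⟨τ, hτ⟩
  · simp [h0]
  · rw [← card_perm_eqOn P τ]
    refine card_le_card fun σ hσ => ?_
    simp only [mem_filter, mem_univ, true_and] at hσ hτ ⊢
    exact fun p hp => (hσ p hp).trans (hτ p hp).symm

theorem pow_three_mul_factorial_le (t : ℕ) (ht : 6 ≤ t) :
    t ^ 3 * (t - 3).factorial ≤ 8 * t.factorial := by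
  obtain ⟨u, rfl⟩ := Nat.exists_eq_add_of_le' (show 3 ≤ t by omega)
  simp only [Nat.add_sub_cancel, Nat.factorial_succ]
  have : (u + 3) ^ 3 ≤ 8 * ((u + 3) * ((u + 2) * (u + 1))) := by
    nlinarith [Nat.zero_le (u ^ 3), Nat.zero_le (u ^ 2)]
  calc _ ≤ 8 * ((u + 3) * ((u + 2) * (u + 1))) * u.factorial := Nat.mul_le_mul_right _ this
    _ = _ := by ring

theorem pow_four_mul_factorial_le (t : ℕ) (ht : 6 ≤ t) :
    t ^ 4 * (t - 4).factorial ≤ 8 * t.factorial := by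
  obtain ⟨u, rfl⟩ := Nat.exists_eq_add_of_le' ht
  simp only [show u + 6 - 4 = u + 2 by omega]
  rw [show (u + 6).factorial = (u + 6) * ((u + 5) * ((u + 4) * ((u + 3) * (u + 2).factorial))) by
    simp only [Nat.factorial_succ]]
  have : (u + 6) ^ 4 ≤ 8 * ((u + 6) * ((u + 5) * ((u + 4) * (u + 3)))) := by
    nlinarith [Nat.zero_le (u ^ 4), Nat.zero_le (u ^ 3), Nat.zero_le (u ^ 2)]
  calc _ ≤ 8 * ((u + 6) * ((u + 5) * ((u + 4) * (u + 3)))) * (u + 2).factorial :=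
        Nat.mul_le_mul_right _ this
    _ = _ := by ring

open Finset in
theorem card_perm_three_le {V : Type*} [Fintype V] [DecidableEq V] (hV : 6 ≤ Fintype.card V)
    {p q r : V} (hpq : p ≠ q) (hpr : p ≠ r) (hqr : q ≠ r) (a b c : V) :
    Fintype.card V ^ 3 * #(univ.filter fun σ : Equiv.Perm V => σ p = a ∧ σ q = b ∧ σ r = c) ≤
      8 * (Fintype.card V).factorial := by
  refine le_trans (Nat.mul_le_mul_left _ ?_) (pow_three_mul_factorial_le _ hV)
  have h := card_perm_agree_le {p, q, r} (fun x => if x = p then a else if x = q then b else c)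
  rw [card_eq_three.2 ⟨p, q, r, hpq, hpr, hqr, rfl⟩] at h
  refine le_trans (card_le_card fun σ hσ => ?_) h
  simp only [mem_filter, mem_univ, true_and, mem_insert, mem_singleton] at hσ ⊢
  rintro x (rfl | rfl | rfl)
  · simp [hσ.1]
  · simp [hσ.2.1, hpq.symm]
  · simp [hσ.2.2, hpr.symm, hqr.symm]

open Finset in
theorem card_perm_four_le {V : Type*} [Fintype V] [DecidableEq V] (hV : 6 ≤ Fintype.card V)
    {p q r s : V} (hpq : p ≠ q) (hpr : p ≠ r) (hps : p ≠ s) (hqr : q ≠ r) (hqs : q ≠ s)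
    (hrs : r ≠ s) (a b c d : V) :
    Fintype.card V ^ 4 *
      #(univ.filter fun σ : Equiv.Perm V => σ p = a ∧ σ q = b ∧ σ r = c ∧ σ s = d) ≤
      8 * (Fintype.card V).factorial := by
  refine le_trans (Nat.mul_le_mul_left _ ?_) (pow_four_mul_factorial_le _ hV)
  have h := card_perm_agree_le {p, q, r, s}
    (fun x => if x = p then a else if x = q then b else if x = r then c else d)
  have h4 : #({p, q, r, s} : Finset V) = 4 := by
    rw [card_insert_of_notMem (by simp [hpq, hpr, hps]),
      card_eq_three.2 ⟨q, r, s, hqr, hqs, hrs, rfl⟩]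
  rw [h4] at h
  refine le_trans (card_le_card fun σ hσ => ?_) h
  simp only [mem_filter, mem_univ, true_and, mem_insert, mem_singleton] at hσ ⊢
  rintro x (rfl | rfl | rfl | rfl)
  · simp [hσ.1]
  · simp [hσ.2.1, hpq.symm]
  · simp [hσ.2.2.1, hpr.symm, hqr.symm]
  · simp [hσ.2.2.2, hps.symm, hqs.symm, hrs.symm]

-- Serves clashes between adjacent steps, where only one position `q` is new: t values at `r'`, at
-- most k at `q`, and probability at most 8/t³ for each triple.
open Finset in
theorem card_perm_one_mem_le {V : Type*} [Fintype V] [DecidableEq V] (hV : 6 ≤ Fintype.card V)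
    {k : ℕ} (D : V → Finset V) (hD : ∀ b, #(D b) ≤ k) {r r' q : V} (hrr : r ≠ r') (hrq : r ≠ q)
    (hrq' : r' ≠ q) (v : V) :
    Fintype.card V ^ 2 * #(univ.filter fun σ : Equiv.Perm V => σ r = v ∧ σ q ∈ D (σ r')) ≤
      8 * k * (Fintype.card V).factorial := by
  set t := Fintype.card V with ht
  have hsub : (univ.filter fun σ : Equiv.Perm V => σ r = v ∧ σ q ∈ D (σ r')) ⊆
      univ.biUnion fun b => (D b).biUnion fun c =>
        univ.filter fun σ : Equiv.Perm V => σ r = v ∧ σ r' = b ∧ σ q = c := by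
    intro σ hσ
    simp only [mem_filter, mem_univ, true_and, mem_biUnion] at hσ ⊢
    exact ⟨σ r', σ q, hσ.2, hσ.1, rfl, rfl⟩
  have h1 : t ^ 3 * #(univ.filter fun σ : Equiv.Perm V => σ r = v ∧ σ q ∈ D (σ r')) ≤
      t * (k * (8 * t.factorial)) := by
    calc _ ≤ t ^ 3 * ∑ b : V, ∑ c ∈ D b,
          #(univ.filter fun σ : Equiv.Perm V => σ r = v ∧ σ r' = b ∧ σ q = c) :=
          Nat.mul_le_mul_left _ <| (card_le_card hsub).trans <| card_biUnion_le.trans <|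
            sum_le_sum fun b _ => card_biUnion_le
      _ = ∑ b : V, ∑ c ∈ D b, t ^ 3 *
          #(univ.filter fun σ : Equiv.Perm V => σ r = v ∧ σ r' = b ∧ σ q = c) := by
          simp only [mul_sum]
      _ ≤ ∑ b : V, ∑ c ∈ D b, 8 * t.factorial :=
          sum_le_sum fun b _ => sum_le_sum fun c _ => card_perm_three_le hV hrr hrq hrq' _ _ _
      _ ≤ ∑ b : V, k * (8 * t.factorial) := sum_le_sum fun b _ => by
          rw [sum_const, smul_eq_mul]; exact Nat.mul_le_mul_right _ (hD b)
      _ = _ := by rw [sum_const, card_univ, smul_eq_mul]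
  refine Nat.le_of_mul_le_mul_left (c := t) ?_ (by omega)
  calc _ = t ^ 3 * #(univ.filter fun σ : Equiv.Perm V => σ r = v ∧ σ q ∈ D (σ r')) := by ring
    _ ≤ _ := h1
    _ = _ := by ring

-- Serves clashes between disjoint steps: both ends of the second step are new, so there are at most
-- t k² choices, each of probability at most 8/t⁴.
open Finset in
theorem card_perm_two_mem_le {V : Type*} [Fintype V] [DecidableEq V] (hV : 6 ≤ Fintype.card V)
    {k : ℕ} (D : V → Finset V) (hD : ∀ b, #(D b) ≤ k) {r r' p q : V} (hrr : r ≠ r')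
    (hrp : r ≠ p) (hrq : r ≠ q) (hrp' : r' ≠ p) (hrq' : r' ≠ q) (hpq : p ≠ q) (v : V) :
    Fintype.card V ^ 3 *
      #(univ.filter fun σ : Equiv.Perm V => σ r = v ∧ σ p ∈ D (σ r') ∧ σ q ∈ D (σ r')) ≤
      8 * k ^ 2 * (Fintype.card V).factorial := by
  set t := Fintype.card V with ht
  have hsub : (univ.filter fun σ : Equiv.Perm V =>
        σ r = v ∧ σ p ∈ D (σ r') ∧ σ q ∈ D (σ r')) ⊆
      univ.biUnion fun b => (D b ×ˢ D b).biUnion fun c =>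
        univ.filter fun σ : Equiv.Perm V => σ r = v ∧ σ r' = b ∧ σ p = c.1 ∧ σ q = c.2 := by
    intro σ hσ
    simp only [mem_filter, mem_univ, true_and, mem_biUnion, mem_product] at hσ ⊢
    exact ⟨σ r', (σ p, σ q), hσ.2, hσ.1, rfl, rfl, rfl⟩
  have h1 : t ^ 4 * #(univ.filter fun σ : Equiv.Perm V =>
      σ r = v ∧ σ p ∈ D (σ r') ∧ σ q ∈ D (σ r')) ≤ t * (k * k * (8 * t.factorial)) := by
    calc _ ≤ t ^ 4 * ∑ b : V, ∑ c ∈ D b ×ˢ D b, #(univ.filter fun σ : Equiv.Perm V =>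
            σ r = v ∧ σ r' = b ∧ σ p = c.1 ∧ σ q = c.2) :=
          Nat.mul_le_mul_left _ <| (card_le_card hsub).trans <| card_biUnion_le.trans <|
            sum_le_sum fun b _ => card_biUnion_le
      _ = ∑ b : V, ∑ c ∈ D b ×ˢ D b, t ^ 4 * #(univ.filter fun σ : Equiv.Perm V =>
            σ r = v ∧ σ r' = b ∧ σ p = c.1 ∧ σ q = c.2) := by
          simp only [mul_sum]
      _ ≤ ∑ b : V, ∑ c ∈ D b ×ˢ D b, 8 * t.factorial :=
          sum_le_sum fun b _ => sum_le_sum fun c _ =>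
            card_perm_four_le hV hrr hrp hrq hrp' hrq' hpq _ _ _ _
      _ ≤ ∑ b : V, k * k * (8 * t.factorial) := sum_le_sum fun b _ => by
          rw [sum_const, smul_eq_mul, card_product]
          exact Nat.mul_le_mul_right _ (Nat.mul_le_mul (hD b) (hD b))
      _ = _ := by rw [sum_const, card_univ, smul_eq_mul]
  refine Nat.le_of_mul_le_mul_left (c := t) ?_ (by omega)
  calc _ = t ^ 4 * #(univ.filter fun σ : Equiv.Perm V =>
        σ r = v ∧ σ p ∈ D (σ r') ∧ σ q ∈ D (σ r')) := by ring
    _ ≤ _ := h1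
    _ = _ := by ring

/-! ### Counting colour clashes in a random tour. -/

/-- The steps at `i` and `j` of the closed tour `σ` use the same colour. -/
def Clash {V E : Type*} (s : Equiv.Perm V) (h : V → V → E) (σ : Equiv.Perm V) (i j : V) : Prop :=
  i ≠ j ∧ h (σ i) (σ (s i)) = h (σ j) (σ (s j))

theorem Clash.symm {V E : Type*} {s : Equiv.Perm V} {h : V → V → E} {σ : Equiv.Perm V} {i j : V}
    (hc : Clash s h σ i j) : Clash s h σ j i :=
  ⟨hc.1.symm, hc.2.symm⟩

open Finset Classical in
/-- The number of pairs of a position `j` and a tour with the value `v` at `r ∈ {i, s i}` and a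
clash between `i` and `j`. -/
theorem card_clash_value_le {V E : Type*} [Fintype V] (hV : 6 ≤ Fintype.card V)
    {k : ℕ} (hk : 1 ≤ k) (s : Equiv.Perm V) (hs : ∀ i, s i ≠ i) (hs2 : ∀ i, s (s i) ≠ i)
    (h : V → V → E) (m : E → Finset V) (hm : ∀ a b, #(m (h a b)) ≤ k)
    (hmem : ∀ a b, a ≠ b → a ∈ m (h a b) ∧ b ∈ m (h a b)) (i r v : V) (hr : r = i ∨ r = s i) :
    Fintype.card V ^ 2 *
      ∑ j, #(univ.filter fun σ : Equiv.Perm V => Clash s h σ i j ∧ σ r = v) ≤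
      24 * k ^ 2 * (Fintype.card V).factorial := by
  set t := Fintype.card V with ht
  -- `r'` is the other end of step `i`, and `D b` the vertex set of that step's colour once `r'` has
  -- value `b`. A clashing step must have both ends in it.
  obtain ⟨r', D, hrr, hr', hD, hDm⟩ : ∃ (r' : V) (D : V → Finset V), r ≠ r' ∧
      (∀ q, q ≠ i → q ≠ s i → r ≠ q ∧ r' ≠ q) ∧ (∀ b, #(D b) ≤ k) ∧
      ∀ σ : Equiv.Perm V, σ r = v → D (σ r') = m (h (σ i) (σ (s i))) := by
    rcases hr with rfl | rfl
    · exact ⟨s r, fun b => m (h v b), (hs r).symm, fun q h1 h2 => ⟨h1.symm, h2.symm⟩,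
        fun b => hm _ _, fun σ h => by rw [h]⟩
    · exact ⟨i, fun b => m (h b v), hs i, fun q h1 h2 => ⟨h2.symm, h1.symm⟩,
        fun b => hm _ _, fun σ h => by rw [h]⟩
  have hcl : ∀ j (σ : Equiv.Perm V), Clash s h σ i j ∧ σ r = v →
      σ r = v ∧ σ j ∈ D (σ r') ∧ σ (s j) ∈ D (σ r') := by
    rintro j σ ⟨hc, hv⟩
    rw [hDm σ hv, hc.2]
    exact ⟨hv, hmem _ _ fun h => hs j (σ.injective h).symm⟩
  set f : V → ℕ := fun j => #(univ.filter fun σ : Equiv.Perm V => Clash s h σ i j ∧ σ r = v)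
    with hf
  have hself : f i = 0 := by
    simp only [hf, card_eq_zero, filter_eq_empty_iff]
    exact fun σ _ hc => hc.1.1 rfl
  have hnext : t ^ 2 * f (s i) ≤ 8 * k * t.factorial := by
    obtain ⟨h1, h2⟩ := hr' (s (s i)) (hs2 i) (hs _)
    refine le_trans (Nat.mul_le_mul_left _ (card_le_card ?_))
      (card_perm_one_mem_le hV D hD hrr h1 h2 v)
    intro σ hσ
    simp only [mem_filter, mem_univ, true_and] at hσ ⊢
    exact ⟨hσ.2, (hcl _ _ hσ).2.2⟩
  have hprev : t ^ 2 * f (s.symm i) ≤ 8 * k * t.factorial := by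
    obtain ⟨h1, h2⟩ := hr' (s.symm i) (fun h => hs i ((Equiv.symm_apply_eq s).1 h).symm)
      (fun h => hs2 i ((Equiv.symm_apply_eq s).1 h).symm)
    refine le_trans (Nat.mul_le_mul_left _ (card_le_card ?_))
      (card_perm_one_mem_le hV D hD hrr h1 h2 v)
    intro σ hσ
    simp only [mem_filter, mem_univ, true_and] at hσ ⊢
    exact ⟨hσ.2, (hcl _ _ hσ).2.1⟩
  have hfar : ∀ j, j ≠ i → j ≠ s i → j ≠ s.symm i →
      t ^ 3 * f j ≤ 8 * k ^ 2 * t.factorial := by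
    intro j h1 h2 h3
    obtain ⟨h4, h5⟩ := hr' j h1 h2
    obtain ⟨h6, h7⟩ := hr' (s j) (fun h => h3 (by rw [← h]; simp)) (fun h => h1 (s.injective h))
    refine le_trans (Nat.mul_le_mul_left _ (card_le_card ?_))
      (card_perm_two_mem_le hV D hD hrr h4 h6 h5 h7 (hs j).symm v)
    intro σ hσ
    simp only [mem_filter, mem_univ, true_and] at hσ ⊢
    exact hcl _ _ hσ
  have hkk : 8 * k * t.factorial ≤ 8 * k ^ 2 * t.factorial :=
    Nat.mul_le_mul_right _ (by nlinarith)
  have htpos : 0 < t := by omega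
  refine Nat.le_of_mul_le_mul_left (c := t) ?_ htpos
  -- The two adjacent steps each weigh as much as the bound for all far steps together, whence 24 =
  -- 3 · 8.
  have hbound : ∀ j, t ^ 3 * f j ≤ 8 * k ^ 2 * t.factorial +
      ((if j = s i then t * (8 * k ^ 2 * t.factorial) else 0) +
        if j = s.symm i then t * (8 * k ^ 2 * t.factorial) else 0) := by
    intro j
    by_cases h1 : j = s i
    · subst h1
      rw [if_pos rfl]
      have := Nat.mul_le_mul_left t (hnext.trans hkk)
      rw [← mul_assoc, show t * t ^ 2 = t ^ 3 by ring] at this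
      omega
    by_cases h2 : j = s.symm i
    · subst h2
      rw [if_pos rfl]
      have := Nat.mul_le_mul_left t (hprev.trans hkk)
      rw [← mul_assoc, show t * t ^ 2 = t ^ 3 by ring] at this
      omega
    by_cases h3 : j = i
    · rw [h3, hself]; simp
    · exact (hfar j h3 h1 h2).trans (Nat.le_add_right _ _)
  calc t * (t ^ 2 * ∑ j, f j) = ∑ j, t ^ 3 * f j := by rw [← mul_sum]; ring
    _ ≤ ∑ j, _ := sum_le_sum fun j _ => hbound j
    _ = t * (24 * k ^ 2 * t.factorial) := by
      rw [sum_add_distrib, sum_add_distrib, sum_const, card_univ, sum_ite_eq' univ,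
        sum_ite_eq' univ]
      simp only [mem_univ, if_true, smul_eq_mul]
      ring

open Finset Classical in
theorem card_clash_le {V E : Type*} [Fintype V] (hV : 6 ≤ Fintype.card V)
    {k : ℕ} (hk : 1 ≤ k) (s : Equiv.Perm V) (hs : ∀ i, s i ≠ i) (hs2 : ∀ i, s (s i) ≠ i)
    (h : V → V → E) (m : E → Finset V) (hm : ∀ a b, #(m (h a b)) ≤ k)
    (hmem : ∀ a b, a ≠ b → a ∈ m (h a b) ∧ b ∈ m (h a b)) (i : V) :
    Fintype.card V * ∑ j, #(univ.filter fun σ : Equiv.Perm V => Clash s h σ i j) ≤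
      24 * k ^ 2 * (Fintype.card V).factorial := by
  set t := Fintype.card V with ht
  have hsplit : ∀ j, #(univ.filter fun σ : Equiv.Perm V => Clash s h σ i j) =
      ∑ v, #(univ.filter fun σ : Equiv.Perm V => Clash s h σ i j ∧ σ i = v) := by
    intro j
    rw [card_eq_sum_card_fiberwise (f := fun σ : Equiv.Perm V => σ i) (t := univ)
      (fun _ _ => mem_coe.2 (mem_univ _))]
    simp only [filter_filter]
  refine Nat.le_of_mul_le_mul_left (c := t) ?_ (by omega)
  calc _ = ∑ v, t ^ 2 *
        ∑ j, #(univ.filter fun σ : Equiv.Perm V => Clash s h σ i j ∧ σ i = v) := by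
        simp only [hsplit]
        rw [sum_comm, ← mul_sum]
        ring
    _ ≤ ∑ v : V, 24 * k ^ 2 * t.factorial :=
        sum_le_sum fun v _ => card_clash_value_le hV hk s hs hs2 h m hm hmem i i v (.inl rfl)
    _ = _ := by rw [sum_const, card_univ, smul_eq_mul]

open Finset in
theorem card_filter_triple {V W : Type*} [Fintype V] [Fintype W] (Q : V → V → W → Prop)
    [DecidablePred fun x : V × V × W => Q x.1 x.2.1 x.2.2] [∀ i j, DecidablePred (Q i j)] :
    #(univ.filter fun x : V × V × W => Q x.1 x.2.1 x.2.2) =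
      ∑ i, ∑ j, #(univ.filter fun w => Q i j w) := by
  simp only [card_filter, Fintype.sum_prod_type]

-- Up to exchanging the two steps, step `i` meets `y` in one of four ways: `i` or `s i` is the
-- position `y.1`, or carries the value `y.2`. Each way costs 24, and the exchange doubles: 192 = 2
-- · 4 · 24.
open Finset Classical in
theorem card_clash_touching_le {V E : Type*} [Fintype V] (hV : 6 ≤ Fintype.card V)
    {k : ℕ} (hk : 1 ≤ k) (s : Equiv.Perm V) (hs : ∀ i, s i ≠ i) (hs2 : ∀ i, s (s i) ≠ i)
    (h : V → V → E) (m : E → Finset V) (hm : ∀ a b, #(m (h a b)) ≤ k)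
    (hmem : ∀ a b, a ≠ b → a ∈ m (h a b) ∧ b ∈ m (h a b)) (y : V × V) :
    Fintype.card V * #(univ.filter fun x : V × V × Equiv.Perm V => Clash s h x.2.2 x.1 x.2.1 ∧
        ∃ p ∈ ({x.1, s x.1, x.2.1, s x.2.1} : Finset V), y.1 = p ∨ y.2 = x.2.2 p) ≤
      192 * k ^ 2 * (Fintype.card V).factorial := by
  set t := Fintype.card V with ht
  have hpos : ∀ i₀, t * #(univ.filter fun x : V × V × Equiv.Perm V =>
      Clash s h x.2.2 x.1 x.2.1 ∧ x.1 = i₀) ≤ 24 * k ^ 2 * t.factorial := by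
    intro i₀
    rw [card_filter_triple (fun i j σ => Clash s h σ i j ∧ i = i₀), sum_eq_single i₀]
    · refine le_trans (Nat.mul_le_mul_left _ (sum_le_sum fun j _ => card_le_card ?_))
        (card_clash_le hV hk s hs hs2 h m hm hmem i₀)
      intro σ hσ
      simp only [mem_filter, mem_univ, true_and] at hσ ⊢
      exact hσ.1
    · intro i _ hi
      simp [hi]
    · simp
  have hval : ∀ r : V → V, (∀ i, r i = i ∨ r i = s i) →
      t * #(univ.filter fun x : V × V × Equiv.Perm V =>
        Clash s h x.2.2 x.1 x.2.1 ∧ x.2.2 (r x.1) = y.2) ≤ 24 * k ^ 2 * t.factorial := by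
    intro r hr
    rw [card_filter_triple (fun i j σ => Clash s h σ i j ∧ σ (r i) = y.2)]
    refine Nat.le_of_mul_le_mul_left (c := t) ?_ (by omega)
    calc _ = ∑ i, t ^ 2 * ∑ j, #(univ.filter fun σ : Equiv.Perm V =>
          Clash s h σ i j ∧ σ (r i) = y.2) := by rw [← mul_sum]; ring
      _ ≤ ∑ i : V, 24 * k ^ 2 * t.factorial := sum_le_sum fun i _ =>
          card_clash_value_le hV hk s hs hs2 h m hm hmem i (r i) y.2 (hr i)
      _ = _ := by rw [sum_const, card_univ, smul_eq_mul]
  set U₁ := univ.filter fun x : V × V × Equiv.Perm V => Clash s h x.2.2 x.1 x.2.1 ∧ x.1 = y.1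
    with hU₁
  set U₂ := univ.filter fun x : V × V × Equiv.Perm V =>
    Clash s h x.2.2 x.1 x.2.1 ∧ x.1 = s.symm y.1 with hU₂
  set U₃ := univ.filter fun x : V × V × Equiv.Perm V =>
    Clash s h x.2.2 x.1 x.2.1 ∧ x.2.2 x.1 = y.2 with hU₃
  set U₄ := univ.filter fun x : V × V × Equiv.Perm V =>
    Clash s h x.2.2 x.1 x.2.1 ∧ x.2.2 (s x.1) = y.2 with hU₄
  have h1 : t * #U₁ ≤ 24 * k ^ 2 * t.factorial := hpos _
  have h2 : t * #U₂ ≤ 24 * k ^ 2 * t.factorial := hpos _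
  have h3 : t * #U₃ ≤ 24 * k ^ 2 * t.factorial := hval id fun i => .inl rfl
  have h4 : t * #U₄ ≤ 24 * k ^ 2 * t.factorial := hval s fun i => .inr rfl
  set U := U₁ ∪ U₂ ∪ U₃ ∪ U₄ with hU
  have hUle : t * #U ≤ 96 * k ^ 2 * t.factorial := by
    have : #U ≤ #U₁ + #U₂ + #U₃ + #U₄ :=
      (card_union_le _ _).trans <| Nat.add_le_add_right ((card_union_le _ _).trans <|
        Nat.add_le_add_right (card_union_le _ _) _) _
    have := Nat.mul_le_mul_left t this
    linarith
  have hmemU : ∀ x : V × V × Equiv.Perm V, Clash s h x.2.2 x.1 x.2.1 →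
      (x.1 = y.1 ∨ x.1 = s.symm y.1 ∨ x.2.2 x.1 = y.2 ∨ x.2.2 (s x.1) = y.2) → x ∈ U := by
    intro x hx h
    simp only [hU, hU₁, hU₂, hU₃, hU₄, mem_union, mem_filter, mem_univ, true_and]
    tauto
  have hsub : (univ.filter fun x : V × V × Equiv.Perm V => Clash s h x.2.2 x.1 x.2.1 ∧
        ∃ p ∈ ({x.1, s x.1, x.2.1, s x.2.1} : Finset V), y.1 = p ∨ y.2 = x.2.2 p) ⊆
      U ∪ U.image fun x => (x.2.1, x.1, x.2.2) := by
    rintro ⟨i, j, σ⟩ hx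
    simp only [mem_filter, mem_univ, true_and, mem_insert, mem_singleton] at hx
    obtain ⟨hc, p, hp, hy⟩ := hx
    have hcase : ∀ q, (p = q ∨ p = s q) →
        (q = y.1 ∨ q = s.symm y.1 ∨ σ q = y.2 ∨ σ (s q) = y.2) := by
      rintro q (rfl | rfl)
      · rcases hy with hy | hy
        · exact .inl hy.symm
        · exact .inr (.inr (.inl hy.symm))
      · rcases hy with hy | hy
        · exact .inr (.inl (by rw [hy]; simp))
        · exact .inr (.inr (.inr hy.symm))
    rw [← or_assoc] at hp
    rcases hp with hp | hp
    · exact mem_union_left _ (hmemU _ hc (hcase i hp))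
    · exact mem_union_right _ (mem_image.2
        ⟨(j, i, σ), hmemU (j, i, σ) hc.symm (hcase j hp), rfl⟩)
  have hle : #(univ.filter fun x : V × V × Equiv.Perm V => Clash s h x.2.2 x.1 x.2.1 ∧
        ∃ p ∈ ({x.1, s x.1, x.2.1, s x.2.1} : Finset V), y.1 = p ∨ y.2 = x.2.2 p) ≤ #U + #U :=
    (card_le_card hsub).trans <| (card_union_le _ _).trans <|
      Nat.add_le_add_left card_image_le _
  have := Nat.mul_le_mul_left t hle
  linarith

open Finset Classical in
/-- In a sufficiently large complete digraph coloured so that every colour lives on at most `k`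
vertices, there is a rainbow tour of any cyclic shape without short cycles. -/
theorem exists_rainbow_tour {V E : Type*} [Fintype V] {k : ℕ} (hk : 1 ≤ k)
    (hV : 3072 * k ^ 2 ≤ Fintype.card V)
    (s : Equiv.Perm V) (hs : ∀ i, s i ≠ i) (hs2 : ∀ i, s (s i) ≠ i)
    (h : V → V → E) (m : E → Finset V) (hm : ∀ a b, #(m (h a b)) ≤ k)
    (hmem : ∀ a b, a ≠ b → a ∈ m (h a b) ∧ b ∈ m (h a b)) :
    ∃ σ : Equiv.Perm V, Function.Injective fun i => h (σ i) (σ (s i)) := by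
  have hV6 : 6 ≤ Fintype.card V := by nlinarith
  let support : V × V × Equiv.Perm V → Finset V := fun x => {x.1, s x.1, x.2.1, s x.2.1}
  let graph : V × V × Equiv.Perm V → Finset (V × V) :=
    fun x => (support x).image fun p => (p, x.2.2 p)
  let C := univ.filter fun x : V × V × Equiv.Perm V => Clash s h x.2.2 x.1 x.2.1
  let R : Finset (V × V) → Finset (V × V) → Prop :=
    fun M M' => ∃ x ∈ M, ∃ y ∈ M', x.1 = y.1 ∨ x.2 = y.2
  have hcard : Fintype.card (Equiv.Perm V) = (Fintype.card V).factorial := Fintype.card_perm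
  have hext : ∀ x σ, σ ∈ permsExtending (graph x) ↔ ∀ p ∈ support x, σ p = x.2.2 p := by
    intro x σ
    simp only [permsExtending, graph, mem_filter, mem_univ, true_and, forall_mem_image]
  obtain ⟨σ, hσ⟩ : (avoiding permsExtending (C.image graph)).Nonempty := by
    refine avoiding_nonempty permsExtending R (C.image graph) ?_ ?_ ?_
    · intro M hM
      obtain ⟨x, _, rfl⟩ := mem_image.1 hM
      have hx : (x.1, x.2.2 x.1) ∈ graph x := mem_image_of_mem _ (mem_insert_self _ _)
      exact ⟨_, hx, _, hx, .inl rfl⟩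
    · exact fun M _ S _ hS => card_permsExtending_inter_avoiding_le M S hS
    · intro M hM
      have hMcard : #M ≤ 4 := by
        obtain ⟨x, _, rfl⟩ := mem_image.1 hM
        exact card_image_le.trans card_le_four
      have hle : ∑ M' ∈ (C.image graph).filter (R M), #(permsExtending M') ≤
          ∑ y ∈ M, #(univ.filter fun x : V × V × Equiv.Perm V => Clash s h x.2.2 x.1 x.2.1 ∧
            ∃ p ∈ support x, y.1 = p ∨ y.2 = x.2.2 p) := by
        -- A pair of a bad matching and a permutation `τ` extending it comes from a triple (i, j,
        -- τ): `τ` itself clashes at `i`, `j`, and the matching is its restriction. So the sum is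
        -- bounded by counting clashes.
        rw [← card_sigma]
        refine le_trans (card_le_card (t := (M.biUnion fun y =>
          univ.filter fun x : V × V × Equiv.Perm V => Clash s h x.2.2 x.1 x.2.1 ∧
            ∃ p ∈ support x, y.1 = p ∨ y.2 = x.2.2 p).image fun x => ⟨graph x, x.2.2⟩) ?_)
          (card_image_le.trans card_biUnion_le)
        rintro ⟨M', τ⟩ hM'
        obtain ⟨h1, h2⟩ := mem_sigma.1 hM'
        obtain ⟨h3, h4⟩ := mem_filter.1 h1
        obtain ⟨⟨i, j, ρ⟩, hx, rfl⟩ := mem_image.1 h3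
        have hc : Clash s h ρ i j := (mem_filter.1 hx).2
        have hτ : ∀ p ∈ support (i, j, τ), τ p = ρ p := (hext _ _).1 h2
        have hgr : graph (i, j, ρ) = graph (i, j, τ) :=
          image_congr fun p hp => by simp [hτ p hp]
        refine mem_image.2 ⟨(i, j, τ), ?_, by simp [hgr]⟩
        obtain ⟨y, hy, z, hz, hyz⟩ := h4
        rw [hgr] at hz
        obtain ⟨p, hp, rfl⟩ := mem_image.1 hz
        refine mem_biUnion.2 ⟨y, hy, mem_filter.2 ⟨mem_univ _, ⟨hc.1, ?_⟩, p, hp, hyz⟩⟩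
        have e1 := hτ i (by simp [support])
        have e2 := hτ (s i) (by simp [support])
        have e3 := hτ j (by simp [support])
        have e4 := hτ (s j) (by simp [support])
        simp only [e1, e2, e3, e4]
        exact hc.2
      -- `M` has at most four pairs, so 768 = 4 · 192; the factor 4 in the local lemma makes it
      -- 3072.
      have hsum : Fintype.card V *
          ∑ M' ∈ (C.image graph).filter (R M), #(permsExtending M') ≤
          768 * k ^ 2 * (Fintype.card V).factorial := by
        calc _ ≤ _ := Nat.mul_le_mul_left _ hle
          _ = ∑ y ∈ M, Fintype.card V * #(univ.filter fun x : V × V × Equiv.Perm V =>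
              Clash s h x.2.2 x.1 x.2.1 ∧ ∃ p ∈ support x, y.1 = p ∨ y.2 = x.2.2 p) := by
              rw [mul_sum]
          _ ≤ ∑ y ∈ M, 192 * k ^ 2 * (Fintype.card V).factorial := sum_le_sum fun y _ =>
              card_clash_touching_le hV6 hk s hs hs2 h m hm hmem y
          _ = #M * (192 * k ^ 2 * (Fintype.card V).factorial) := by
              rw [sum_const, smul_eq_mul]
          _ ≤ 4 * (192 * k ^ 2 * (Fintype.card V).factorial) := Nat.mul_le_mul_right _ hMcard
          _ = _ := by ring
      rw [hcard]
      refine Nat.le_of_mul_le_mul_left (c := Fintype.card V) ?_ (by omega)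
      calc _ = 4 * (Fintype.card V *
            ∑ M' ∈ (C.image graph).filter (R M), #(permsExtending M')) := by ring
        _ ≤ 4 * (768 * k ^ 2 * (Fintype.card V).factorial) := Nat.mul_le_mul_left _ hsum
        _ = 3072 * k ^ 2 * (Fintype.card V).factorial := by ring
        _ ≤ _ := Nat.mul_le_mul_right _ hV
  refine ⟨σ, fun i j hij => ?_⟩
  by_contra hne
  have hx : (i, j, σ) ∈ C := mem_filter.2 ⟨mem_univ _, hne, hij⟩
  simp only [avoiding, mem_filter] at hσ
  exact hσ.2 _ (mem_image_of_mem graph hx) ((hext _ _).2 fun p _ => rfl)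

/-! ### Shifting weight: covered supports and Maclaurin's inequality. -/

/-- The polynomial form `∑_{e ∈ 𝓔} ∏_{v ∈ e} x v` of a finite family of finite sets. -/
def edgeForm {α : Type*} (𝓔 : Finset (Finset α)) (x : α → ℝ) : ℝ :=
  ∑ e ∈ 𝓔, ∏ v ∈ e, x v

theorem edgeForm_mono {α : Type*} {𝓔 𝓕 : Finset (Finset α)} (h : 𝓔 ⊆ 𝓕) {x : α → ℝ}
    (hx : ∀ v, 0 ≤ x v) : edgeForm 𝓔 x ≤ edgeForm 𝓕 x :=
  Finset.sum_le_sum_of_subset_of_nonneg h fun _ _ _ => Finset.prod_nonneg fun v _ => hx v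

/-- As a function of two coordinates, the polynomial form is affine in each of them. -/
theorem exists_edgeForm_update {α : Type*} [DecidableEq α] (𝓔 : Finset (Finset α)) {x : α → ℝ}
    (hx : ∀ v, 0 ≤ x v) {i j : α} (hij : i ≠ j) :
    ∃ A B C D : ℝ, (∀ p q, edgeForm 𝓔 (Function.update (Function.update x i p) j q) =
      A + B * p + C * q + D * (p * q)) ∧ 0 ≤ D ∧ ((∀ e ∈ 𝓔, ¬ (i ∈ e ∧ j ∈ e)) → D = 0) := by
  induction 𝓔 using Finset.induction_on with
  | empty => exact ⟨0, 0, 0, 0, by simp [edgeForm], le_rfl, fun _ => rfl⟩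
  | insert e 𝓔 he ih =>
    obtain ⟨A, B, C, D, h, hD, hD'⟩ := ih
    have hform : ∀ y : α → ℝ, edgeForm (insert e 𝓔) y = ∏ v ∈ e, y v + edgeForm 𝓔 y :=
      fun y => Finset.sum_insert he
    by_cases hi : i ∈ e
    · by_cases hj : j ∈ e
      · refine ⟨A, B, C, D + ∏ v ∈ (e \ {j}) \ {i}, x v, fun p q => ?_,
          add_nonneg hD (Finset.prod_nonneg fun v _ => hx v),
          fun hno => absurd ⟨hi, hj⟩ (hno e (Finset.mem_insert_self _ _))⟩
        rw [hform, h, Finset.prod_update_of_mem hj,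
          Finset.prod_update_of_mem (by simp [hi, hij])]
        ring
      · refine ⟨A, B + ∏ v ∈ e \ {i}, x v, C, D, fun p q => ?_, hD,
          fun hno => hD' fun f hf => hno f (Finset.mem_insert_of_mem hf)⟩
        rw [hform, h, Finset.prod_update_of_notMem hj, Finset.prod_update_of_mem hi]
        ring
    · by_cases hj : j ∈ e
      · refine ⟨A, B, C + ∏ v ∈ e \ {j}, x v, D, fun p q => ?_, hD,
          fun hno => hD' fun f hf => hno f (Finset.mem_insert_of_mem hf)⟩
        rw [hform, h, Finset.prod_update_of_mem hj,
          Finset.prod_update_of_notMem (by simp [hi])]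
        ring
      · refine ⟨A + ∏ v ∈ e, x v, B, C, D, fun p q => ?_, hD,
          fun hno => hD' fun f hf => hno f (Finset.mem_insert_of_mem hf)⟩
        rw [hform, h, Finset.prod_update_of_notMem hj, Finset.prod_update_of_notMem hi]
        ring

theorem update_update_self {α : Type*} [DecidableEq α] (x : α → ℝ) (i j : α) :
    Function.update (Function.update x i (x i)) j (x j) = x := by
  rw [Function.update_eq_self, Function.update_eq_self]

theorem sum_update_update {α : Type*} [DecidableEq α] {W : Finset α} (x : α → ℝ) {i j : α}
    (hij : i ≠ j) (hi : i ∈ W) (hj : j ∈ W) {p q : ℝ} (hpq : p + q = x i + x j) :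
    ∑ v ∈ W, Function.update (Function.update x i p) j q v = ∑ v ∈ W, x v := by
  have key : ∀ p q, ∑ v ∈ W, Function.update (Function.update x i p) j q v =
      q + (p + ∑ v ∈ (W \ {j}) \ {i}, x v) := fun p q => by
    rw [Finset.sum_update_of_mem hj, Finset.sum_update_of_mem (by simp [hi, hij])]
  have h0 := key (x i) (x j)
  rw [update_update_self] at h0
  rw [key, h0]
  linarith

theorem update_update_nonneg {α : Type*} [DecidableEq α] {x : α → ℝ} (hx : ∀ v, 0 ≤ x v)
    (i j : α) {p q : ℝ} (hp : 0 ≤ p) (hq : 0 ≤ q) (v : α) :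
    0 ≤ Function.update (Function.update x i p) j q v := by
  simp only [Function.update_apply]
  split_ifs
  · exact hq
  · exact hp
  · exact hx v

/-- Progress measure of both weight-shifting inductions: `c = 0` when shrinking the support, `c` the
mean in Maclaurin's inequality. -/
theorem card_filter_update_update_lt {α : Type*} [DecidableEq α] {W : Finset α} (x : α → ℝ)
    {i j : α} {p q c : ℝ} (hi : i ∈ W) (hj : j ∈ W) (hxi : x i ≠ c) (hxj : x j ≠ c)
    (hij : i ≠ j) (h : p = c ∨ q = c) :
    (W.filter fun v => Function.update (Function.update x i p) j q v ≠ c).card <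
      (W.filter fun v => x v ≠ c).card := by
  apply Finset.card_lt_card
  rw [Finset.ssubset_iff_of_subset]
  · rcases h with rfl | rfl
    · exact ⟨i, by simp [hi, hxi], by simp [hij]⟩
    · exact ⟨j, by simp [hj, hxj], by simp⟩
  · intro v hv
    simp only [Finset.mem_filter] at hv ⊢
    refine ⟨hv.1, fun hvc => hv.2 ?_⟩
    have h1 : v ≠ i := fun h => hxi (h ▸ hvc)
    have h2 : v ≠ j := fun h => hxj (h ▸ hvc)
    simpa [h1, h2] using hvc

/-- Weight can be moved so that the polynomial form does not decrease and any two vertices of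
the support lie in a common member of the family. -/
theorem exists_edgeForm_le_of_covered {α : Type*} [DecidableEq α] (𝓔 : Finset (Finset α))
    (W : Finset α) (x : α → ℝ) (hx : ∀ v, 0 ≤ x v) (hxW : ∀ v ∉ W, x v = 0) :
    ∃ y : α → ℝ, (∀ v, 0 ≤ y v) ∧ (∀ v ∉ W, y v = 0) ∧ ∑ v ∈ W, y v = ∑ v ∈ W, x v ∧
      edgeForm 𝓔 x ≤ edgeForm 𝓔 y ∧
      ∀ u v, u ≠ v → y u ≠ 0 → y v ≠ 0 → ∃ e ∈ 𝓔, u ∈ e ∧ v ∈ e := by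
  induction hn : (W.filter fun v => x v ≠ 0).card using Nat.strong_induction_on generalizing x with
  | _ n ih =>
  by_cases hcov : ∀ u v, u ≠ v → x u ≠ 0 → x v ≠ 0 → ∃ e ∈ 𝓔, u ∈ e ∧ v ∈ e
  · exact ⟨x, hx, hxW, rfl, le_rfl, hcov⟩
  push Not at hcov
  obtain ⟨i, j, hij, hi, hj, hno⟩ := hcov
  have hiW : i ∈ W := by_contra fun h => hi (hxW i h)
  have hjW : j ∈ W := by_contra fun h => hj (hxW j h)
  obtain ⟨A, B, C, D, hF, -, hD⟩ := exists_edgeForm_update 𝓔 hx hij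
  have hD0 : D = 0 := hD fun e he h => hno e he h.1 h.2
  subst hD0
  have hFx := hF (x i) (x j)
  rw [update_update_self] at hFx
  -- With no mixed term, all the weight of the pair goes to the vertex with the larger coefficient.
  obtain ⟨p, q, hp, hq, hpq, h0, hle⟩ : ∃ p q : ℝ, 0 ≤ p ∧ 0 ≤ q ∧ p + q = x i + x j ∧
      (p = 0 ∨ q = 0) ∧ B * x i + C * x j ≤ B * p + C * q := by
    have h1 := hx i
    have h2 := hx j
    rcases le_total B C with h | h
    · exact ⟨0, x i + x j, le_rfl, by positivity, by ring, .inl rfl, by nlinarith⟩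
    · exact ⟨x i + x j, 0, by positivity, le_rfl, by ring, .inr rfl, by nlinarith⟩
  have hyW : ∀ v ∉ W, Function.update (Function.update x i p) j q v = 0 := by
    intro v hv
    have h1 : v ≠ i := fun h => hv (h ▸ hiW)
    have h2 : v ≠ j := fun h => hv (h ▸ hjW)
    simpa [h1, h2] using hxW v hv
  obtain ⟨y, hy, hyW', hsum, hle', hcov⟩ := ih _
    (hn ▸ card_filter_update_update_lt x hiW hjW hi hj hij h0) _
    (update_update_nonneg hx i j hp hq) hyW rfl
  refine ⟨y, hy, hyW', hsum.trans (sum_update_update x hij hiW hjW hpq), le_trans ?_ hle', hcov⟩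
  rw [hF, hFx]
  linarith

theorem edgeForm_powersetCard_comp_swap {α : Type*} [DecidableEq α] (W : Finset α) (k : ℕ)
    {i j : α} (hi : i ∈ W) (hj : j ∈ W) (x : α → ℝ) :
    edgeForm (W.powersetCard k) (x ∘ Equiv.swap i j) = edgeForm (W.powersetCard k) x := by
  have hmem : ∀ e ∈ W.powersetCard k,
      e.map (Equiv.swap i j).toEmbedding ∈ W.powersetCard k := by
    intro e he
    rw [Finset.mem_powersetCard] at he ⊢
    refine ⟨fun v hv => ?_, by rw [Finset.card_map, he.2]⟩
    obtain ⟨w, hw, rfl⟩ := Finset.mem_map.1 hv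
    have := he.1 hw
    simp only [Equiv.coe_toEmbedding, Equiv.swap_apply_def]
    split_ifs <;> assumption
  have hinv : ∀ e : Finset α,
      (e.map (Equiv.swap i j).toEmbedding).map (Equiv.swap i j).toEmbedding = e := by
    intro e
    ext v
    simp [Finset.mem_map_equiv]
  refine Finset.sum_nbij' (fun e => e.map (Equiv.swap i j).toEmbedding)
    (fun e => e.map (Equiv.swap i j).toEmbedding) hmem hmem (fun e _ => hinv e)
    (fun e _ => hinv e) fun e _ => ?_
  rw [Finset.prod_map]
  rfl

/-- Maclaurin's inequality for elementary symmetric polynomials. -/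
theorem edgeForm_powersetCard_le {α : Type*} [DecidableEq α] (W : Finset α) (k : ℕ)
    (hW : W.Nonempty) (x : α → ℝ) (hx : ∀ v, 0 ≤ x v) (hsum : ∑ v ∈ W, x v = 1) :
    edgeForm (W.powersetCard k) x ≤ (W.card.choose k : ℝ) / (W.card : ℝ) ^ k := by
  have hWpos : (0 : ℝ) < W.card := by exact_mod_cast hW.card_pos
  set c : ℝ := (W.card : ℝ)⁻¹ with hc
  have hcW : ∑ _v ∈ W, c = 1 := by
    rw [Finset.sum_const, nsmul_eq_mul, hc, mul_inv_cancel₀ hWpos.ne']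
  induction hn : (W.filter fun v => x v ≠ c).card using Nat.strong_induction_on generalizing x with
  | _ n ih =>
  by_cases hall : ∀ v ∈ W, x v = c
  · refine le_of_eq ?_
    rw [edgeForm, Finset.sum_congr rfl (g := fun _ => c ^ k), Finset.sum_const,
      Finset.card_powersetCard, nsmul_eq_mul, hc, inv_pow, div_eq_mul_inv]
    intro e he
    rw [Finset.mem_powersetCard] at he
    rw [Finset.prod_congr rfl fun v hv => hall v (he.1 hv), Finset.prod_const, he.2]
  have hlt : ∃ i ∈ W, x i < c := by
    by_contra! h
    exact hall fun v hv => ((Finset.sum_eq_sum_iff_of_le h).1 (hcW.trans hsum.symm) v hv).symm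
  have hgt : ∃ j ∈ W, c < x j := by
    by_contra! h
    exact hall fun v hv => (Finset.sum_eq_sum_iff_of_le h).1 (hsum.trans hcW.symm) v hv
  obtain ⟨i, hi, hxi⟩ := hlt
  obtain ⟨j, hj, hxj⟩ := hgt
  have hij : i ≠ j := fun h => by subst h; exact lt_asymm hxi hxj
  obtain ⟨A, B, C, D, hF, hD, -⟩ := exists_edgeForm_update (W.powersetCard k) hx hij
  -- Symmetry makes the linear part depend on p + q only, so the shift matters only through `D`.
  have hsymm : ∀ p q, A + B * p + C * q + D * (p * q) = A + B * q + C * p + D * (q * p) := by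
    intro p q
    rw [← hF, ← hF, ← edgeForm_powersetCard_comp_swap W k hi hj]
    congr 1
    funext v
    by_cases h1 : v = i
    · subst h1; simp [hij]
    · by_cases h2 : v = j
      · subst h2; simp [hij]
      · simp [h1, h2, Equiv.swap_apply_of_ne_of_ne]
  have hBC : B = C := by linarith [hsymm 1 0]
  have hFx := hF (x i) (x j)
  rw [update_update_self] at hFx
  have hc0 : 0 ≤ c := (hx i).trans hxi.le
  -- Setting one of the two weights to the mean raises their product by (c - x i)(x j - c) ≥ 0.
  have hstep := ih _ (hn ▸ card_filter_update_update_lt x (p := c) (q := x i + x j - c)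
      hi hj hxi.ne hxj.ne' hij (.inl rfl)) _
    (update_update_nonneg hx i j hc0 (by linarith [hx i]))
    ((sum_update_update x hij hi hj (by ring)).trans hsum) rfl
  refine le_trans ?_ hstep
  rw [hF, hFx, hBC]
  nlinarith [mul_nonneg hD (mul_nonneg (sub_nonneg.2 hxi.le) (sub_nonneg.2 hxj.le))]

/-! ### Lagrangians of hypergraphs through finite families. -/

namespace Hypergraph

/-- The hyperedges of a hypergraph on the finite vertex set `W`, as finite sets. -/
noncomputable def finEdges {α : Type*} (H : Hypergraph α) (W : Finset α) : Finset (Finset α) :=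
  open Classical in W.powerset.filter fun e => (e : Set α) ∈ H.edgeSet

theorem subset_of_mem_finEdges {α : Type*} {H : Hypergraph α} {W e : Finset α}
    (he : e ∈ H.finEdges W) : e ⊆ W := by
  simp only [finEdges, Finset.mem_filter, Finset.mem_powerset] at he
  exact he.1

theorem mem_finEdges {α : Type*} {H : Hypergraph α} {W : Finset α} (hW : H.vertexSet = W)
    {e : Finset α} : e ∈ H.finEdges W ↔ (e : Set α) ∈ H.edgeSet := by
  simp only [finEdges, Finset.mem_filter, Finset.mem_powerset, and_iff_right_iff_imp]
  intro he
  have := H.subset_vertexSet_of_mem_edgeSet' he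
  rwa [hW, Finset.coe_subset] at this

theorem polyForm_eq_edgeForm {α : Type*} {H : Hypergraph α} {W : Finset α}
    (hW : H.vertexSet = W) (x : α → ℝ) : H.polyForm x = edgeForm (H.finEdges W) x := by
  have himg : H.edgeSet = (fun e : Finset α => (e : Set α)) '' (H.finEdges W : Set (Finset α)) := by
    ext e
    constructor
    · intro he
      have hsub := H.subset_vertexSet_of_mem_edgeSet' he
      rw [hW] at hsub
      obtain ⟨e', rfl⟩ := (W.finite_toSet.subset hsub).exists_finset_coe
      exact ⟨e', (mem_finEdges hW).2 he, rfl⟩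
    · rintro ⟨e', he', rfl⟩
      exact (mem_finEdges hW).1 he'
  rw [polyForm, himg, finsum_mem_image Finset.coe_injective.injOn, finsum_mem_coe_finset]
  exact Finset.sum_congr rfl fun e _ => finprod_mem_coe_finset _ _

theorem finEdges_subset_powersetCard {α : Type*} {H : Hypergraph α} {W : Finset α}
    (hW : H.vertexSet = W) {k : ℕ} (hk : H.IsUniform k) :
    H.finEdges W ⊆ W.powersetCard k := by
  intro e he
  rw [Finset.mem_powersetCard]
  refine ⟨subset_of_mem_finEdges he, ?_⟩
  have := hk _ ((mem_finEdges hW).1 he)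
  rw [Set.encard_coe_eq_coe_finsetCard] at this
  exact_mod_cast this

/-- To bound the Lagrangian it suffices to consider weightings vanishing off the vertex set. -/
theorem lagrangian_le {α : Type*} {H : Hypergraph α} {W : Finset α} (hW : H.vertexSet = W)
    (hne : W.Nonempty) {c : ℝ}
    (hc : ∀ x : α → ℝ, (∀ v, 0 ≤ x v) → (∀ v ∉ W, x v = 0) → ∑ v ∈ W, x v = 1 →
      edgeForm (H.finEdges W) x ≤ c) : H.lagrangian ≤ c := by
  classical
  obtain ⟨x, ⟨hx0, hx1⟩, hx⟩ := (H.isGreatest_lagrangian (hW ▸ W.finite_toSet)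
    (hW ▸ Finset.coe_nonempty.2 hne)).1
  rw [← hx, polyForm_eq_edgeForm hW]
  rw [hW] at hx0 hx1
  rw [finsum_mem_coe_finset] at hx1
  have hWx : ∀ v ∈ W, (if v ∈ W then x v else 0) = x v := fun v hv => if_pos hv
  -- A maximising weighting is unconstrained off `W`, so it is cut to zero there.
  refine le_trans (le_of_eq ?_) (hc (fun v => if v ∈ W then x v else 0) ?_ ?_ ?_)
  · refine Finset.sum_congr rfl fun e he => Finset.prod_congr rfl fun v hv => ?_
    exact (hWx v (subset_of_mem_finEdges he hv)).symm
  · intro v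
    split_ifs with hv
    · exact hx0 v hv
    · exact le_rfl
  · intro v hv
    exact if_neg hv
  · rw [← hx1]
    refine Finset.sum_congr rfl fun v hv => ?_
    rw [hWx v hv, abs_of_nonneg (hx0 v hv)]

/-- A hypergraph containing all `k`-subsets of `S` has Lagrangian at least that of the complete
`k`-graph on `S`. -/
theorem le_lagrangian_of_powersetCard_subset {α : Type*} {H : Hypergraph α} {W S : Finset α}
    (hW : H.vertexSet = W) (hS : S.Nonempty) (hSW : S ⊆ W) {k : ℕ}
    (hk : S.powersetCard k ⊆ H.finEdges W) :
    (S.card.choose k : ℝ) / (S.card : ℝ) ^ k ≤ H.lagrangian := by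
  classical
  have hpos : (0 : ℝ) < S.card := by exact_mod_cast hS.card_pos
  set x : α → ℝ := fun v => if v ∈ S then (S.card : ℝ)⁻¹ else 0 with hx
  have hx0 : ∀ v, 0 ≤ x v := fun v => by
    simp only [hx]; split_ifs <;> positivity
  have hxw : x ∈ H.weightings := by
    refine ⟨fun v _ => hx0 v, ?_⟩
    rw [hW, finsum_mem_coe_finset]
    simp only [abs_of_nonneg (hx0 _)]
    simp only [hx]
    rw [Finset.sum_ite_mem, Finset.inter_eq_right.2 hSW, Finset.sum_const, nsmul_eq_mul,
      mul_inv_cancel₀ hpos.ne']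
  have hle := (H.isGreatest_lagrangian (hW ▸ W.finite_toSet)
    (hW ▸ Finset.coe_nonempty.2 (hS.mono hSW))).2 ⟨x, hxw, rfl⟩
  refine le_trans ?_ hle
  rw [polyForm_eq_edgeForm hW]
  refine le_trans (le_of_eq ?_) (edgeForm_mono hk hx0)
  rw [edgeForm, Finset.sum_congr rfl (g := fun _ => ((S.card : ℝ)⁻¹) ^ k), Finset.sum_const,
    Finset.card_powersetCard, nsmul_eq_mul, inv_pow, div_eq_mul_inv]
  intro e he
  rw [Finset.mem_powersetCard] at he
  rw [Finset.prod_congr rfl fun v hv => (if_pos (he.1 hv) : x v = _), Finset.prod_const, he.2]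

theorem lagrangian_completeUniform (k m : ℕ) (hm : 1 ≤ m) :
    (completeUniform k m).lagrangian = (m.choose k : ℝ) / (m : ℝ) ^ k := by
  have hW : (completeUniform k m).vertexSet = (Finset.univ : Finset (Fin m)) := by
    simp [completeUniform]
  have : Nonempty (Fin m) := ⟨⟨0, hm⟩⟩
  have huni : (completeUniform k m).IsUniform k := fun e he => he
  apply le_antisymm
  · refine lagrangian_le hW Finset.univ_nonempty fun x hx _ hsum => ?_
    refine (edgeForm_mono (finEdges_subset_powersetCard hW huni) hx).trans ?_
    simpa using edgeForm_powersetCard_le Finset.univ k Finset.univ_nonempty x hx hsum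
  · have := le_lagrangian_of_powersetCard_subset (k := k) hW
      (S := Finset.univ) Finset.univ_nonempty Finset.Subset.rfl ?_
    · simpa using this
    · intro e he
      rw [mem_finEdges hW]
      change (e : Set (Fin m)).encard = k
      rw [Set.encard_coe_eq_coe_finsetCard, (Finset.mem_powersetCard.1 he).2]

/-! ### Berge cycles and the extremal bound. -/

/-- A set of `t` vertices, any two of which lie in a common hyperedge, carries a Berge cycle of
length `t`, provided that `t` is large compared to the size of the hyperedges. -/
theorem hasBergeCycle_of_covered {α : Type*} {H : Hypergraph α} {k t : ℕ} (hk : 1 ≤ k)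
    (ht : 3072 * k ^ 2 ≤ t) (𝓔 : Finset (Finset α)) (h𝓔 : ∀ e ∈ 𝓔, (e : Set α) ∈ H.edgeSet)
    (hcard : ∀ e ∈ 𝓔, e.card ≤ k) (T : Finset α) (hT : T.card = t)
    (hcov : ∀ u ∈ T, ∀ v ∈ T, u ≠ v → ∃ e ∈ 𝓔, u ∈ e ∧ v ∈ e) : H.HasBergeCycle t := by
  classical
  have ht3 : 3 ≤ t := by nlinarith
  let φ : Fin t ≃ T := (T.equivFinOfCardEq hT).symm
  have hφ : Function.Injective fun i => (φ i : α) := Subtype.val_injective.comp φ.injective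
  -- On the diagonal the colour is a dummy ∅, which only has to respect the size bound; a tour never
  -- uses it.
  have hex : ∀ a b : Fin t, ∃ e : Finset α, e.card ≤ k ∧
      (a ≠ b → e ∈ 𝓔 ∧ (φ a : α) ∈ e ∧ (φ b : α) ∈ e) := by
    intro a b
    by_cases hab : a = b
    · exact ⟨∅, by simp, fun h => absurd hab h⟩
    · obtain ⟨e, he, h⟩ := hcov _ (φ a).2 _ (φ b).2 fun h => hab (hφ h)
      exact ⟨e, hcard e he, fun _ => ⟨he, h⟩⟩
  choose h hhk hh using hex
  have hrot : ∀ i, finRotate t i ≠ i := by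
    obtain ⟨u, rfl⟩ := Nat.exists_eq_add_of_le' ht3
    intro i hi
    rw [finRotate_apply, add_eq_left] at hi
    simp at hi
  have hrot2 : ∀ i, finRotate t (finRotate t i) ≠ i := by
    obtain ⟨u, rfl⟩ := Nat.exists_eq_add_of_le' ht3
    intro i hi
    rw [finRotate_apply, finRotate_apply, add_assoc, add_eq_left] at hi
    simp only [Fin.ext_iff, Fin.val_add, Fin.val_one, Fin.val_zero] at hi
    rw [Nat.mod_eq_of_lt (by omega)] at hi
    omega
  obtain ⟨σ, hσ⟩ := exists_rainbow_tour hk (by simpa using ht) (finRotate t) hrot hrot2 h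
    (fun e => Finset.univ.filter fun a => (φ a : α) ∈ e)
    (fun a b => (Finset.card_le_card_of_injOn (fun a => (φ a : α))
      (fun c hc => by simpa using hc) hφ.injOn).trans (hhk a b))
    (fun a b hab => by simpa using (hh a b hab).2)
  have hne : ∀ i, σ i ≠ σ (finRotate t i) := fun i hi => hrot i (σ.injective hi).symm
  refine ⟨ht3, fun i => φ (σ i), fun i => (h (σ i) (σ (finRotate t i)) : Set α),
    hφ.comp σ.injective, fun i j hij => hσ (Finset.coe_injective hij), fun i => ?_⟩
  obtain ⟨h1, h2, h3⟩ := hh _ _ (hne i)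
  exact ⟨h𝓔 _ h1, h2, h3⟩

/-- After shifting weight onto a pairwise covered support, `t` support vertices would carry a Berge
cycle. So the support is smaller, and Maclaurin's inequality applies. -/
theorem lagrangian_le_of_not_hasBergeCycle {α : Type*} {H : Hypergraph α} {k t : ℕ} (hk : 1 ≤ k)
    (ht : 3072 * k ^ 2 ≤ t) (hfin : H.vertexSet.Finite) (hcard : t ≤ H.vertexSet.ncard + 1)
    (huni : H.IsUniform k) (hfree : ¬ H.HasBergeCycle t) :
    H.lagrangian ≤ (completeUniform k (t - 1)).lagrangian := by
  classical
  have ht2 : 2 ≤ t := by nlinarith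
  rw [lagrangian_completeUniform k (t - 1) (by omega)]
  obtain ⟨W, hW⟩ := hfin.exists_finset_coe
  replace hW := hW.symm
  rw [hW, Set.ncard_coe_finset] at hcard
  refine lagrangian_le hW (Finset.card_pos.1 (by omega)) fun x hx hxW hsum => ?_
  obtain ⟨y, hy, hyW, hysum, hle, hcov⟩ := exists_edgeForm_le_of_covered (H.finEdges W) W x hx hxW
  refine hle.trans ?_
  have hsub := finEdges_subset_powersetCard hW huni
  by_cases hbig : t ≤ (W.filter fun v => y v ≠ 0).card
  · obtain ⟨T, hT, hTcard⟩ := Finset.exists_subset_card_eq hbig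
    refine absurd (hasBergeCycle_of_covered hk ht (H.finEdges W)
      (fun e he => (mem_finEdges hW).1 he)
      (fun e he => (Finset.mem_powersetCard.1 (hsub he)).2.le) T hTcard ?_) hfree
    intro u hu v hv huv
    exact hcov u v huv (Finset.mem_filter.1 (hT hu)).2 (Finset.mem_filter.1 (hT hv)).2
  -- Padding the support to exactly `t - 1` vertices, possible as `W` has that many, avoids
  -- comparing complete hypergraphs of different orders.
  · obtain ⟨S, hS, hSW, hScard⟩ := Finset.exists_subsuperset_card_eq (n := t - 1)
      (Finset.filter_subset (fun v => y v ≠ 0) W) (by omega) (by omega)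
    have hyS : ∀ v ∉ S, y v = 0 := by
      intro v hv
      by_contra h
      exact hv (hS (Finset.mem_filter.2 ⟨by_contra fun h' => h (hyW v h'), h⟩))
    have hSsum : ∑ v ∈ S, y v = 1 := by
      rw [Finset.sum_subset hSW fun v _ hv => hyS v hv, hysum, hsum]
    have hform : edgeForm (H.finEdges W) y ≤ edgeForm (S.powersetCard k) y := by
      rw [edgeForm, ← Finset.sum_filter_add_sum_filter_not _ (fun e => e ⊆ S),
        Finset.sum_eq_zero (s := Finset.filter (fun e => ¬ e ⊆ S) _), add_zero]
      · refine edgeForm_mono (fun e he => ?_) hy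
        obtain ⟨h1, h2⟩ := Finset.mem_filter.1 he
        exact Finset.mem_powersetCard.2 ⟨h2, (Finset.mem_powersetCard.1 (hsub h1)).2⟩
      · intro e he
        obtain ⟨v, hv, hvS⟩ := Finset.not_subset.1 (Finset.mem_filter.1 he).2
        exact Finset.prod_eq_zero hv (hyS v hvS)
    have := edgeForm_powersetCard_le S k (Finset.card_pos.1 (by omega)) y hy hSsum
    rw [hScard] at this
    exact hform.trans this

/-- The `k`-graph whose hyperedges are the `k`-subsets of `S`; vertices off `S` are isolated. -/
def completeUniformOn {α : Type*} (k : ℕ) (S : Set α) : Hypergraph α where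
  vertexSet := Set.univ
  edgeSet := {e | e ⊆ S ∧ e.encard = k}
  subset_vertexSet_of_mem_edgeSet' := fun _ _ => Set.subset_univ _

/-- Every vertex of a Berge cycle lies in one of its hyperedges, hence in `S`, which is too small.
-/
theorem completeUniformOn_not_hasBergeCycle {α : Type*} (k t : ℕ) (S : Finset α) (hS : S.card < t) :
    ¬ (completeUniformOn k (S : Set α)).HasBergeCycle t := by
  rintro ⟨-, v, h, hv, -, hh⟩
  have := Finset.card_le_card_of_injOn (s := Finset.univ) (t := S) v
    (fun i _ => (hh i).1.1 (hh i).2.1) hv.injOn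
  simp only [Finset.card_univ, Fintype.card_fin] at this
  omega

end Hypergraph

theorem theorem1p6 (k : ℕ) (hk : 2 ≤ k) :
    ∃ t₀ : ℕ, ∀ t : ℕ, t₀ ≤ t →
      (Hypergraph.completeUniform k (t - 1)).lagrangian =
          ((t - 1).choose k : ℝ) / ((t : ℝ) - 1) ^ k ∧
      ∀ n : ℕ, t ≤ n + 1 →
        (∀ (α : Type u) (H : Hypergraph α), H.vertexSet.Finite → H.vertexSet.ncard = n →
          H.IsUniform k → ¬ H.HasBergeCycle t →
            H.lagrangian ≤ (Hypergraph.completeUniform k (t - 1)).lagrangian) ∧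
        (∃ H : Hypergraph (Fin n), H.vertexSet = Set.univ ∧ H.IsUniform k ∧
          ¬ H.HasBergeCycle t ∧
            H.lagrangian = (Hypergraph.completeUniform k (t - 1)).lagrangian) := by
  refine ⟨3072 * k ^ 2, fun t ht => ?_⟩
  have ht2 : 2 ≤ t := by nlinarith
  have hk1 : 1 ≤ k := by omega
  have hlag := Hypergraph.lagrangian_completeUniform k (t - 1) (by omega)
  refine ⟨?_, fun n hn => ⟨fun α H hfin hcard huni hfree => ?_, ?_⟩⟩
  · rw [hlag, Nat.cast_sub (by omega), Nat.cast_one]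
  · exact Hypergraph.lagrangian_le_of_not_hasBergeCycle hk1 ht hfin (by omega) huni hfree
  -- The extremal example is complete on `t - 1` of the `n` vertices, the others being isolated.
  · obtain ⟨S, -, hS⟩ := Finset.exists_subset_card_eq (s := (Finset.univ : Finset (Fin n)))
      (n := t - 1) (by simp; omega)
    have hW : (Hypergraph.completeUniformOn k (S : Set (Fin n))).vertexSet =
        (Finset.univ : Finset (Fin n)) := by simp [Hypergraph.completeUniformOn]
    have hfree := Hypergraph.completeUniformOn_not_hasBergeCycle k t S (by omega)
    have huni : (Hypergraph.completeUniformOn k (S : Set (Fin n))).IsUniform k := fun e he => he.2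
    refine ⟨Hypergraph.completeUniformOn k (S : Set (Fin n)), rfl, huni, hfree, le_antisymm ?_ ?_⟩
    · refine Hypergraph.lagrangian_le_of_not_hasBergeCycle hk1 ht (Set.toFinite _) ?_ huni hfree
      rw [hW, Set.ncard_coe_finset, Finset.card_univ, Fintype.card_fin]
      exact hn
    · rw [hlag, ← hS]
      refine Hypergraph.le_lagrangian_of_powersetCard_subset hW (Finset.card_pos.1 (by omega))
        (Finset.subset_univ _) fun e he => ?_
      rw [Hypergraph.mem_finEdges hW]
      obtain ⟨h1, h2⟩ := Finset.mem_powersetCard.1 he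
      exact ⟨Finset.coe_subset.2 h1, by rw [Set.encard_coe_eq_coe_finsetCard, h2]⟩
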